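/- Let $n,p\ge 0$ be integers, let $X\in\mathbb{R}^{n\times p}$, let $\Lambda\subseteq(0,\infty)$ be a set of tuning parameters, and let $\hat\beta^\lambda=\hat\beta^\lambda_X:\mathbb{R}^n\to\mathbb{R}^p$ ($\lambda\in\Lambda\cup\{1\}$) be estimators. For $\eta\in\{1,0,-1\}^p$ put $W^\lambda(\eta)=\{Y\in\mathbb{R}^n : \operatorname{sgn}[\hat\beta^\lambda(Y)]=\eta\}$, where the sign is taken coordinatewise. Assume: (i) (scale symmetry) $\operatorname{supp}[\hat\beta^\lambda(Y)]=\operatorname{supp}[\hat\beta^1(Y/\lambda)]$ for all $\lambda\in\Lambda$ and $Y\in\mathbb{R}^n$; (ii) for all $\lambda\in\Lambda$ and $\eta\in\{1,0,-1\}^p$, the closure $\operatorname{cl}W^\lambda(\eta)$ is a polyhedron, that is, a finite intersection of closed half-spaces $\{x : a^\top x\le c\}$ (with $a\in\mathbb{R}^n$, $c\in\mathbb{R}$), and the sign vector is constant on its interior, that is, $\operatorname{int}\operatorname{cl}W^\lambda(\eta)\subseteq W^\lambda(\eta)$; (iii) $\Lambda$ is finite, or (for $\Lambda$ arbitrary,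 for instance $\Lambda=(0,\infty)$) every nonempty region is of full dimension: for all $\lambda\in\Lambda$ and $\eta$ with $W^\lambda(\eta)\neq\emptyset$, the set $\operatorname{cl}W^\lambda(\eta)$ has nonempty interior. For a target $\xi=X\beta\in\mathbb{R}^n$ define the robustness radius $$D(\xi)=\inf\bigl\{\|y-\xi\|_\infty : y\in\mathbb{R}^n,\ \exists\lambda\in\Lambda\ \forall\lambda'\in\Lambda:\ \operatorname{supp}[\hat\beta^\lambda(y)]\ne\operatorname{supp}[\hat\beta^{\lambda'}(\xi)]\bigr\}\in[0,\infty],\qquad \inf\emptyset=\infty .$$ Then for all $\xi\in\mathbb{R}^n$ outside a set of Lebesgue measure zero one has $D(\xi)>0$; moreover the support paths are stable: there is an $\varepsilon>0$ such that $\{\operatorname{supp}[\hat\beta^\lambda(y)] : \lambda\in\Lambda\}=\{\operatorname{supp}[\hat\beta^\lambda(\xi)] : \lambda\in\Lambda\}$ for all $y\in\mathbb{R}^n$ with $\|y-\xi\|_\infty<\varepsilon$. -/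

import Mathlib

open MeasureTheory

namespace TuningPath

/-- A family of estimators `l ↦ (X, Y) ↦ β̂^l(Y)`: for every tuning parameter `l`, a function of the
design matrix `X ∈ ℝ^{n × p}` and of the data `Y ∈ ℝⁿ` with values in `ℝᵖ`. Only the members with
`l` in the set `Λ` of tuning parameters (and the reference member `l = 1`) matter below. -/
abbrev EstimatorFamily (n p : ℕ) : Type :=
  ℝ → Matrix (Fin n) (Fin p) ℝ → (Fin n → ℝ) → (Fin p → ℝ)

variable {n p : ℕ}

/-- The active set `supp [β̂^l(y)]`. -/
def activeSet (b : EstimatorFamily n p) (X : Matrix (Fin n) (Fin p) ℝ) (l : ℝ) (y : Fin n → ℝ) :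
    Set (Fin p) :=
  {j | b l X y j ≠ 0}

/-- The region `W^l(η)` of the data whose estimate has sign vector `η ∈ {1, 0, -1}ᵖ`. -/
def signRegion (b : EstimatorFamily n p) (X : Matrix (Fin n) (Fin p) ℝ) (l : ℝ)
    (η : Fin p → SignType) : Set (Fin n → ℝ) :=
  {y | ∀ j, SignType.sign (b l X y j) = η j}

/-- A polyhedron in `ℝⁿ`: a finite intersection of closed half-spaces `{x | aᵀ x ≤ c}`. -/
def IsPolyhedron (V : Set (Fin n → ℝ)) : Prop :=
  ∃ (m : ℕ) (a : Fin m → Fin n → ℝ) (c : Fin m → ℝ), V = {x | ∀ i, a i ⬝ᵥ x ≤ c i}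

/-- Scale symmetry: `supp [β̂^l(Y)] = supp [β̂^1(Y / l)]` for all `l ∈ Λ` and `Y ∈ ℝⁿ`. -/
def IsScaleSymmetric (b : EstimatorFamily n p) (Λ : Set ℝ) (X : Matrix (Fin n) (Fin p) ℝ) : Prop :=
  ∀ l ∈ Λ, ∀ y : Fin n → ℝ, activeSet b X l y = activeSet b X 1 (l⁻¹ • y)

/-- The closed regions of equal sign vector are polyhedra, and the sign vector is constant on the
interior of each of them: `int (cl W^l(η)) ⊆ W^l(η)`. -/
def HasPolyhedralRegions (b : EstimatorFamily n p) (Λ : Set ℝ) (X : Matrix (Fin n) (Fin p) ℝ) :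
    Prop :=
  ∀ l ∈ Λ, ∀ η : Fin p → SignType,
    IsPolyhedron (closure (signRegion b X l η)) ∧
      interior (closure (signRegion b X l η)) ⊆ signRegion b X l η

/-- Every nonempty closed region of equal sign vector is `n`-dimensional. -/
def HasFullDimensionalRegions (b : EstimatorFamily n p) (Λ : Set ℝ)
    (X : Matrix (Fin n) (Fin p) ℝ) : Prop :=
  ∀ l ∈ Λ, ∀ η : Fin p → SignType, (signRegion b X l η).Nonempty →
    (interior (closure (signRegion b X l η))).Nonempty

/-- The support path `{supp [β̂^l(y)] | l ∈ Λ}`. -/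
def supportPath (b : EstimatorFamily n p) (Λ : Set ℝ) (X : Matrix (Fin n) (Fin p) ℝ)
    (y : Fin n → ℝ) : Set (Set (Fin p)) :=
  (fun l => activeSet b X l y) '' Λ

/-- The robustness radius `D(ξ)`, with values in `[0, ∞]` and `inf ∅ = ∞`. The norm of
`Fin n → ℝ` is the sup norm. -/
noncomputable def robustnessRadius (b : EstimatorFamily n p) (Λ : Set ℝ)
    (X : Matrix (Fin n) (Fin p) ℝ) (ξ : Fin n → ℝ) : ENNReal :=
  sInf {r | ∃ y : Fin n → ℝ,
    (∃ l ∈ Λ, ∀ l' ∈ Λ, activeSet b X l y ≠ activeSet b X l' ξ) ∧ r = ENNReal.ofReal ‖y - ξ‖}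

end TuningPath

/-!
The support path of `y` is locally constant near `ξ` as soon as, for each of the finitely many sign
vectors `η`, the point `ξ` is off the frontier of the set of all `y` whose path passes through the
region of `η`. If `Λ` is finite, it is enough that the frontier of each single region is null, which
holds because a region `W` satisfies `int (cl W) ⊆ W` and convex sets have null frontiers
(`addHaar_frontier_of_interior_closure_subset`). Of the polyhedral regions only the convexity of
their closures is used.

If `Λ` is arbitrary, fix `l₀ ∈ Λ`. By scale symmetry the set in question is a union of dilates
`s⁻¹ • W`, `s ∈ T = {l₀ / l | l ∈ Λ}`, of a region `W` of `l₀`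
(`IsScaleSymmetric.mem_supportPath_iff`). Full dimension gives `int V ⊆ W ⊆ cl (int V)` for the
convex set `V = cl W`, so that the frontier of the union lies in the frontier of the open set
`O = ⋃ s⁻¹ • int V`. That frontier is null by `addHaar_frontier_dilates_interior`. Indeed, a frontier
point `x` of `O` is a limit of points `y` of dilates `s⁻¹ • int V`, and there are two cases.

* If `s` can be kept bounded, the dilates contain a ball of radius bounded below, whose distance
  from `x` is at most a fixed multiple of its radius. Its convex hull with `y` is contained in `O`
  and shows that the frontier of `O` is porous at `x` (`exists_closedBall_subset_dilates`), and
  porous sets are null by Lebesgue's density theorem (`measure_eq_zero_of_porous`).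
* If `s → ∞`, then `x` belongs to the recession cone of `V`
  (`mem_rayDirections_of_forall_mem_closure`). It is not interior to that cone, since `s • x` would
  then be in `int V` for all large `s`, whence `x ∈ O` (`eventually_smul_mem_interior`). So `x` lies
  in the frontier of the cone, a convex set.
-/

open Set Filter Metric Topology

namespace TuningPath

/-! ### Frontiers and porous sets -/

section Frontiers

variable {E : Type*} [NormedAddCommGroup E]

theorem eventually_mem_iff_of_notMem_frontier {α : Type*} [TopologicalSpace α] {s : Set α} {x : α}
    (hx : x ∉ frontier s) : ∀ᶠ y in 𝓝 x, (y ∈ s ↔ x ∈ s) := by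
  by_cases h : x ∈ interior s
  · filter_upwards [mem_interior_iff_mem_nhds.1 h] with y hy
    exact iff_of_true hy (interior_subset h)
  · have h' : x ∉ closure s := fun hc => hx ⟨hc, h⟩
    filter_upwards [isClosed_closure.isOpen_compl.mem_nhds h'] with y hy
    exact iff_of_false (fun hys => hy (subset_closure hys)) (fun hxs => h' (subset_closure hxs))

theorem frontier_subset_frontier_of_subset_of_subset_closure {α : Type*} [TopologicalSpace α]
    {s t : Set α} (hst : s ⊆ t) (hts : t ⊆ closure s) : frontier t ⊆ frontier s :=
  sdiff_subset_sdiff (closure_minimal hts isClosed_closure) (interior_mono hst)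

/-- A porous set is null: near a density point of `S`, every ball that is not too far off-centre
compared with its radius meets `S`. -/
theorem measure_eq_zero_of_porous [MeasurableSpace E] [BorelSpace E] [SecondCountableTopology E]
    (μ : Measure E) [IsUnifLocDoublingMeasure μ] [IsLocallyFiniteMeasure μ] {S : Set E}
    (hS : ∀ x ∈ S, ∃ K δ₀ : ℝ, 0 < δ₀ ∧ ∀ δ ∈ Ioc 0 δ₀,
      ∃ w, dist x w ≤ K * δ ∧ Disjoint S (closedBall w δ)) : μ S = 0 := by
  have key : ∀ᵐ x ∂μ.restrict S, x ∉ S := by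
    have h := ae_all_iff.2 fun k : ℕ =>
      IsUnifLocDoublingMeasure.ae_tendsto_measure_inter_div μ S (k : ℝ)
    filter_upwards [h] with x hx hxS
    obtain ⟨K, δ₀, hδ₀, H⟩ := hS x hxS
    obtain ⟨k, hk⟩ := exists_nat_ge K
    choose! w hw using H
    have hmem : ∀ᶠ δ in 𝓝[>] (0 : ℝ), δ ∈ Ioc 0 δ₀ := Ioc_mem_nhdsGT hδ₀
    have hlim := hx k w (fun δ => δ) tendsto_id (by
      filter_upwards [hmem] with δ hδ
      exact (hw δ hδ).1.trans (mul_le_mul_of_nonneg_right hk hδ.1.le))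
    have hzero : (fun δ : ℝ => μ (S ∩ closedBall (w δ) δ) / μ (closedBall (w δ) δ))
        =ᶠ[𝓝[>] 0] fun _ => 0 := by
      filter_upwards [hmem] with δ hδ
      rw [(hw δ hδ).2.inter_eq, measure_empty, ENNReal.zero_div]
    exact one_ne_zero (tendsto_nhds_unique hlim (tendsto_const_nhds.congr' hzero.symm))
  rw [← Measure.restrict_apply_self]
  simpa [ae_iff] using key

end Frontiers

/-! ### Unions of dilates of a convex set -/

section Dilates

variable {E : Type*} [NormedAddCommGroup E] [NormedSpace ℝ E]

/-- The union of the dilates `s⁻¹ • W`, `s ∈ T` (for `T` a set of nonzero reals), written without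
inverses. -/
def dilates (T : Set ℝ) (W : Set E) : Set E :=
  {y | ∃ s ∈ T, s • y ∈ W}

theorem dilates_mono {T T' : Set ℝ} {W W' : Set E} (hT : T ⊆ T') (hW : W ⊆ W') :
    dilates T W ⊆ dilates T' W' := by
  rintro y ⟨s, hs, hy⟩
  exact ⟨s, hT hs, hW hy⟩

theorem isOpen_dilates (T : Set ℝ) {U : Set E} (hU : IsOpen U) : IsOpen (dilates T U) := by
  have : dilates T U = ⋃ s ∈ T, (fun y : E => s • y) ⁻¹' U := by ext; simp [dilates]
  rw [this]
  exact isOpen_biUnion fun s _ => hU.preimage (continuous_const_smul s)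

theorem dilates_closure_subset {T : Set ℝ} (hT : ∀ s ∈ T, 0 < s) (U : Set E) :
    dilates T (closure U) ⊆ closure (dilates T U) := by
  rintro y ⟨s, hs, hy⟩
  have hs0 : s ≠ 0 := (hT s hs).ne'
  have h := map_mem_closure (f := fun z : E => s⁻¹ • z) (t := dilates T U)
    (continuous_const_smul _) hy fun z hz => ⟨s, hs, by rwa [smul_inv_smul₀ hs0]⟩
  simpa [inv_smul_smul₀ hs0] using h

/-- The convex hull of a point `y` of `s⁻¹ • C` and of the ball `s⁻¹ • closedBall c r` contains
balls centred between `y` and `s⁻¹ • c`. -/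
theorem closedBall_subset_dilate {C : Set E} (hC : Convex ℝ C) {c y : E} {r s θ : ℝ}
    (hball : closedBall c r ⊆ C) (hs : 0 < s) (hy : s • y ∈ C) (hθ : 0 < θ) (hθ1 : θ ≤ 1) :
    closedBall ((1 - θ) • y + (θ / s) • c) (θ * r / s) ⊆ {w | s • w ∈ C} := by
  intro w hw
  set w₀ := (1 - θ) • y + (θ / s) • c with hw₀
  have hu : c + (s / θ) • (w - w₀) ∈ C := by
    apply hball
    rw [mem_closedBall, dist_eq_norm] at hw ⊢
    rw [add_sub_cancel_left, norm_smul, Real.norm_of_nonneg (by positivity)]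
    calc s / θ * ‖w - w₀‖ ≤ s / θ * (θ * r / s) := by gcongr
      _ = r := by field_simp
  have h := hC hy hu (sub_nonneg.2 hθ1) hθ.le (by ring)
  have hEq : s • w = (1 - θ) • s • y + θ • (c + (s / θ) • (w - w₀)) := by
    rw [hw₀]
    match_scalars <;> field_simp <;> ring
  change s • w ∈ C
  rwa [hEq]

/-- Dilates of `C` by factors `s⁻¹` bounded below contain balls of a fixed relative size arbitrarily near
each of their limit points. -/
theorem exists_closedBall_subset_dilates {C : Set E} (hC : Convex ℝ C) {c x : E} {r m : ℝ}
    (hr : 0 < r) (hball : closedBall c r ⊆ C) (hm : 0 < m) {T : Set ℝ} (hT : ∀ s ∈ T, 0 < s)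
    (hTm : ∀ s ∈ T, s ≤ m) (hx : x ∈ closure (dilates T C)) :
    ∃ K δ₀ : ℝ, 0 < δ₀ ∧ ∀ δ ∈ Ioc 0 δ₀,
      ∃ w, dist x w ≤ K * δ ∧ closedBall w δ ⊆ dilates T C := by
  refine ⟨1 + (m * (‖x‖ + 1) + ‖c‖) / r, min 1 (r / m), by positivity, ?_⟩
  rintro δ ⟨hδ, hδ'⟩
  obtain ⟨y, ⟨s, hsT, hsy⟩, hxy⟩ := Metric.mem_closure_iff.1 hx δ hδ
  have hs := hT s hsT
  have hsm := hTm s hsT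
  -- `θ` is chosen so that the ball of `closedBall_subset_dilate` has radius `δ`
  set θ := δ * s / r with hθ
  have hθ0 : 0 < θ := by positivity
  have hθm : θ ≤ δ * m / r := by rw [hθ]; gcongr
  have hθ1 : θ ≤ 1 := by
    refine hθm.trans ?_
    rw [div_le_one hr, ← le_div_iff₀ hm]
    exact hδ'.trans (min_le_right _ _)
  have hrad : θ * r / s = δ := by rw [hθ]; field_simp
  have hθs : θ / s = δ / r := by rw [hθ]; field_simp
  refine ⟨(1 - θ) • y + (θ / s) • c, ?_, ?_⟩
  · have hyx : ‖y‖ ≤ ‖x‖ + 1 := by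
      have h1 : ‖y‖ ≤ ‖x‖ + ‖y - x‖ := norm_le_norm_add_norm_sub' y x
      have h2 : ‖y - x‖ < δ := by rwa [← dist_eq_norm, dist_comm]
      linarith [hδ'.trans (min_le_left _ _)]
    have hyw : dist y ((1 - θ) • y + (θ / s) • c) ≤ θ * ‖y‖ + θ / s * ‖c‖ := by
      have : y - ((1 - θ) • y + (θ / s) • c) = θ • y - (θ / s) • c := by module
      rw [dist_eq_norm, this]
      refine (norm_sub_le _ _).trans_eq ?_
      rw [norm_smul, norm_smul, Real.norm_of_nonneg hθ0.le, Real.norm_of_nonneg (by positivity)]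
    calc dist x ((1 - θ) • y + (θ / s) • c)
        ≤ dist x y + dist y ((1 - θ) • y + (θ / s) • c) := dist_triangle _ _ _
      _ ≤ δ + (θ * ‖y‖ + θ / s * ‖c‖) := by gcongr
      _ ≤ δ + (δ * m / r * (‖x‖ + 1) + δ / r * ‖c‖) := by rw [hθs]; gcongr
      _ = (1 + (m * (‖x‖ + 1) + ‖c‖) / r) * δ := by field_simp
  · rw [← hrad]
    exact (closedBall_subset_dilate hC hball hs hsy hθ0 hθ1).trans fun w hw => ⟨s, hsT, hw⟩

/-- The directions `v` in which the ray from `c` stays in `V`: the recession cone of `V`, if `V` is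
closed and convex and `c ∈ V`. -/
def rayDirections (V : Set E) (c : E) : Set E :=
  {v | ∀ t : ℝ, 0 ≤ t → c + t • v ∈ V}

theorem convex_rayDirections {V : Set E} (hV : Convex ℝ V) (c : E) :
    Convex ℝ (rayDirections V c) := by
  intro v hv w hw a b ha hb hab t ht
  have h := hV (hv t ht) (hw t ht) ha hb hab
  convert h using 1
  have hc : c = (a + b) • c := by rw [hab, one_smul]
  nth_rewrite 1 [hc]
  module

/-- Limits of points of dilates `s⁻¹ • V` with `s → ∞` are recession directions of `V`. -/
theorem mem_rayDirections_of_forall_mem_closure {V : Set E} (hV : Convex ℝ V) (hVc : IsClosed V)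
    {c x : E} (hc : c ∈ V) {T : Set ℝ}
    (hx : ∀ m : ℕ, x ∈ closure (dilates (T ∩ Ioi (m : ℝ)) V)) : x ∈ rayDirections V c := by
  intro t ht
  choose y hy hxy using fun m : ℕ =>
    Metric.mem_closure_iff.1 (hx m) (1 / ((m : ℝ) + 1)) Nat.one_div_pos_of_nat
  choose s hs hsy using hy
  have hs_lim : Tendsto s atTop atTop :=
    tendsto_atTop_mono (fun m => (hs m).2.le) tendsto_natCast_atTop_atTop
  have hy_lim : Tendsto y atTop (𝓝 x) := by
    rw [tendsto_iff_dist_tendsto_zero]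
    refine squeeze_zero (fun _ => dist_nonneg) (fun m => ?_) tendsto_one_div_add_atTop_nhds_zero_nat
    rw [dist_comm]
    exact (hxy m).le
  have hts : Tendsto (fun m => t / s m) atTop (𝓝 0) := tendsto_const_nhds.div_atTop hs_lim
  -- the point dividing the segment from `c` to `s m • y m` in the ratio `t / s m` tends to `c + t x`
  have hlim : Tendsto (fun m => (1 - t / s m) • c + t • y m) atTop (𝓝 (c + t • x)) := by
    simpa using ((tendsto_const_nhds (x := (1 : ℝ)).sub hts).smul_const c).add
      (hy_lim.const_smul t)
  refine hVc.mem_of_tendsto hlim ?_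
  filter_upwards [hs_lim.eventually_gt_atTop 0, hs_lim.eventually_ge_atTop t] with m hm0 hmt
  have h := hV hc (hsy m) (sub_nonneg.2 ((div_le_one hm0).2 hmt)) (div_nonneg ht hm0.le) (by ring)
  rwa [smul_smul, div_mul_cancel₀ _ hm0.ne'] at h

/-- A recession direction `x` that is interior to the recession cone has `s • x` interior to `V` for
all large `s`. -/
theorem eventually_smul_mem_interior {V : Set E} {c x : E}
    (hx : x ∈ interior (rayDirections V c)) : ∀ᶠ s : ℝ in atTop, s • x ∈ interior V := by
  have hlim : Tendsto (fun s : ℝ => x - s⁻¹ • c) atTop (𝓝 x) := by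
    simpa using (tendsto_const_nhds (x := x)).sub
      ((tendsto_inv_atTop_zero (𝕜 := ℝ)).smul_const c)
  filter_upwards [hlim.eventually (isOpen_interior.mem_nhds hx), eventually_gt_atTop 0]
    with s hs hs0
  have hcont : Continuous fun z : E => s⁻¹ • (z - c) := by fun_prop
  have hsub : (fun z : E => s⁻¹ • (z - c)) ⁻¹' interior (rayDirections V c) ⊆ V := by
    intro z hz
    have h := interior_subset hz s hs0.le
    rwa [smul_inv_smul₀ hs0.ne', add_sub_cancel] at h
  refine interior_maximal hsub (isOpen_interior.preimage hcont) ?_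
  change s⁻¹ • (s • x - c) ∈ interior (rayDirections V c)
  rwa [smul_sub, inv_smul_smul₀ hs0.ne']

variable [MeasurableSpace E] [BorelSpace E] [FiniteDimensional ℝ E] (μ : Measure E)
  [μ.IsAddHaarMeasure]

/-- A frontier point of the union is either a limit of dilates with bounded `s`, where the frontier is
porous, or a frontier point of the recession cone of `V`. -/
theorem addHaar_frontier_dilates_interior {V : Set E} (hV : Convex ℝ V) (hVc : IsClosed V)
    {T : Set ℝ} (hT : ∀ s ∈ T, 0 < s) : μ (frontier (dilates T (interior V))) = 0 := by
  have : SecondCountableTopology E := secondCountable_of_proper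
  set O := dilates T (interior V) with hO
  have hOopen : IsOpen O := isOpen_dilates T isOpen_interior
  rcases (interior V).eq_empty_or_nonempty with hemp | ⟨c, hc⟩
  · simp [hO, hemp, dilates]
  obtain ⟨r, hr, hball⟩ := Metric.nhds_basis_closedBall.mem_iff.1 (isOpen_interior.mem_nhds hc)
  have hcover : frontier O ⊆ frontier (rayDirections V c) ∪
      ⋃ m : ℕ, frontier O ∩ closure (dilates (T ∩ Iic (m : ℝ)) (interior V)) := by
    intro x hx
    by_cases h : ∃ m : ℕ, x ∈ closure (dilates (T ∩ Iic (m : ℝ)) (interior V))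
    · obtain ⟨m, hm⟩ := h
      exact Or.inr (mem_iUnion.2 ⟨m, hx, hm⟩)
    push Not at h
    have hfar : ∀ m : ℕ, x ∈ closure (dilates (T ∩ Ioi (m : ℝ)) (interior V)) := by
      intro m
      have hsplit : O ⊆ dilates (T ∩ Iic (m : ℝ)) (interior V) ∪
          dilates (T ∩ Ioi (m : ℝ)) (interior V) := by
        rintro y ⟨s, hs, hy⟩
        rcases le_or_gt s m with hsm | hsm
        · exact Or.inl ⟨s, ⟨hs, hsm⟩, hy⟩
        · exact Or.inr ⟨s, ⟨hs, hsm⟩, hy⟩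
      have hx' := closure_mono hsplit (frontier_subset_closure hx)
      rw [closure_union] at hx'
      exact hx'.resolve_left (h m)
    refine Or.inl ⟨subset_closure ?_, fun hint => ?_⟩
    · exact mem_rayDirections_of_forall_mem_closure hV hVc (interior_subset hc) fun m =>
        closure_mono (dilates_mono subset_rfl interior_subset) (hfar m)
    · obtain ⟨s₀, hs₀⟩ := eventually_atTop.1 (eventually_smul_mem_interior hint)
      obtain ⟨m, hm⟩ := exists_nat_ge s₀
      obtain ⟨y, s, hs, -⟩ := closure_nonempty_iff.1 ⟨x, hfar m⟩
      have hxO : x ∈ O := ⟨s, hs.1, hs₀ s (hm.trans (le_of_lt hs.2))⟩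
      exact hx.2 (hOopen.interior_eq.symm ▸ hxO)
  refine measure_mono_null hcover (measure_union_null
    ((convex_rayDirections hV c).addHaar_frontier μ) (measure_iUnion_null fun m => ?_))
  refine measure_eq_zero_of_porous μ fun x hx => ?_
  obtain ⟨K, δ₀, hδ₀, H⟩ := exists_closedBall_subset_dilates hV.interior hr hball
    (m := (m : ℝ) + 1) (by positivity) (T := T ∩ Iic (m : ℝ)) (fun s hs => hT s hs.1)
    (fun s hs => (show s ≤ m from hs.2).trans (by linarith)) hx.2
  refine ⟨K, δ₀, hδ₀, fun δ hδ => ?_⟩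
  obtain ⟨w, hxw, hw⟩ := H δ hδ
  refine ⟨w, hxw, disjoint_left.2 fun z hz hzw => ?_⟩
  have hzO : z ∈ O := dilates_mono inter_subset_left subset_rfl (hw hzw)
  exact hz.1.2 (hOopen.interior_eq.symm ▸ hzO)

/-- A set squeezed between a full-dimensional closed convex set and its interior may replace that
interior in `addHaar_frontier_dilates_interior`. -/
theorem addHaar_frontier_dilates {W : Set E} (hconv : Convex ℝ (closure W))
    (hint : interior (closure W) ⊆ W) (hfull : W.Nonempty → (interior (closure W)).Nonempty)
    {T : Set ℝ} (hT : ∀ s ∈ T, 0 < s) : μ (frontier (dilates T W)) = 0 := by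
  refine measure_mono_null (frontier_subset_frontier_of_subset_of_subset_closure
    (dilates_mono subset_rfl hint) ?_)
    (addHaar_frontier_dilates_interior μ hconv isClosed_closure hT)
  rcases W.eq_empty_or_nonempty with rfl | hne
  · simp [dilates]
  have hcl : W ⊆ closure (interior (closure W)) := by
    rw [hconv.closure_interior_eq_closure_of_nonempty_interior (hfull hne), closure_closure]
    exact subset_closure
  exact (dilates_mono subset_rfl hcl).trans (dilates_closure_subset hT _)

theorem addHaar_frontier_of_interior_closure_subset {W : Set E} (hconv : Convex ℝ (closure W))
    (hint : interior (closure W) ⊆ W) : μ (frontier W) = 0 := by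
  refine measure_mono_null (fun x hx => ?_) (hconv.addHaar_frontier μ)
  exact ⟨subset_closure hx.1, fun h => hx.2 (interior_maximal hint isOpen_interior h)⟩

end Dilates

/-! ### Support paths -/

section SupportPath

variable {n p : ℕ} {b : EstimatorFamily n p} {Λ : Set ℝ} {X : Matrix (Fin n) (Fin p) ℝ}

theorem IsPolyhedron.convex {V : Set (Fin n → ℝ)} (hV : IsPolyhedron V) : Convex ℝ V := by
  obtain ⟨m, a, c, rfl⟩ := hV
  intro x hx y hy s t hs ht hst i
  have h := add_le_add (mul_le_mul_of_nonneg_left (hx i) hs) (mul_le_mul_of_nonneg_left (hy i) ht)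
  rw [← add_mul, hst, one_mul] at h
  simpa [dotProduct_add, dotProduct_smul] using h

theorem activeSet_eq_of_mem_signRegion {l : ℝ} {y : Fin n → ℝ} {η : Fin p → SignType}
    (hy : y ∈ signRegion b X l η) : activeSet b X l y = {j | η j ≠ 0} := by
  ext j
  simp [activeSet, ← hy j, sign_eq_zero_iff]

theorem mem_signRegion_sign (b : EstimatorFamily n p) (X : Matrix (Fin n) (Fin p) ℝ) (l : ℝ)
    (y : Fin n → ℝ) : y ∈ signRegion b X l fun j => SignType.sign (b l X y j) :=
  fun _ => rfl

theorem IsScaleSymmetric.activeSet_eq (h : IsScaleSymmetric b Λ X) {l l₀ : ℝ} (hl : l ∈ Λ)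
    (hl₀ : l₀ ∈ Λ) (h₀ : l₀ ≠ 0) (y : Fin n → ℝ) :
    activeSet b X l y = activeSet b X l₀ ((l₀ / l) • y) := by
  rw [h l hl, h l₀ hl₀, smul_smul]
  congr 2
  field_simp

/-- By scale symmetry, a support occurs on the path of `y` exactly if `y` lies in a dilate of one of
the regions of a single reference parameter `l₀`. -/
theorem IsScaleSymmetric.mem_supportPath_iff (h : IsScaleSymmetric b Λ X) {l₀ : ℝ} (hl₀ : l₀ ∈ Λ)
    (h₀ : l₀ ≠ 0) (y : Fin n → ℝ) (A : Set (Fin p)) :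
    A ∈ supportPath b Λ X y ↔ ∃ η : Fin p → SignType, {j | η j ≠ 0} = A ∧
      y ∈ dilates ((fun l => l₀ / l) '' Λ) (signRegion b X l₀ η) := by
  constructor
  · rintro ⟨l, hl, rfl⟩
    have hmem := mem_signRegion_sign b X l₀ ((l₀ / l) • y)
    refine ⟨_, ?_, l₀ / l, mem_image_of_mem _ hl, hmem⟩
    rw [← activeSet_eq_of_mem_signRegion hmem]
    exact (h.activeSet_eq hl hl₀ h₀ y).symm
  · rintro ⟨η, rfl, _, ⟨l, hl, rfl⟩, hy⟩
    exact ⟨l, hl, (h.activeSet_eq hl hl₀ h₀ y).trans (activeSet_eq_of_mem_signRegion hy)⟩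

theorem ae_eventually_supportPath_eq_of_finite (hpoly : HasPolyhedralRegions b Λ X)
    (hΛ : Λ.Finite) :
    ∀ᵐ ξ : Fin n → ℝ ∂volume, ∀ᶠ y in 𝓝 ξ, supportPath b Λ X y = supportPath b Λ X ξ := by
  have hae : ∀ᵐ ξ : Fin n → ℝ ∂volume, ∀ l ∈ Λ, ∀ η, ξ ∉ frontier (signRegion b X l η) := by
    refine (ae_ball_iff hΛ.countable).2 fun l hl => ae_all_iff.2 fun η => ?_
    exact measure_eq_zero_iff_ae_notMem.1 (addHaar_frontier_of_interior_closure_subset volume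
      (hpoly l hl η).1.convex (hpoly l hl η).2)
  filter_upwards [hae] with ξ hξ
  have hloc : ∀ᶠ y in 𝓝 ξ, ∀ l ∈ Λ, activeSet b X l y = activeSet b X l ξ := by
    refine (eventually_all_finite hΛ).2 fun l hl => ?_
    have hmem := mem_signRegion_sign b X l ξ
    filter_upwards [eventually_mem_iff_of_notMem_frontier (hξ l hl _)] with y hy
    rw [activeSet_eq_of_mem_signRegion (hy.2 hmem), activeSet_eq_of_mem_signRegion hmem]
  filter_upwards [hloc] with y hy
  exact image_congr hy

theorem ae_eventually_supportPath_eq_of_fullDimensional (hpos : ∀ l ∈ Λ, 0 < l)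
    (hscale : IsScaleSymmetric b Λ X) (hpoly : HasPolyhedralRegions b Λ X)
    (hfull : HasFullDimensionalRegions b Λ X) :
    ∀ᵐ ξ : Fin n → ℝ ∂volume, ∀ᶠ y in 𝓝 ξ, supportPath b Λ X y = supportPath b Λ X ξ := by
  rcases Λ.eq_empty_or_nonempty with rfl | ⟨l₀, hl₀⟩
  · simp [supportPath]
  have hT : ∀ s ∈ (fun l => l₀ / l) '' Λ, 0 < s := by
    rintro _ ⟨l, hl, rfl⟩
    exact div_pos (hpos l₀ hl₀) (hpos l hl)
  have hae : ∀ᵐ ξ : Fin n → ℝ ∂volume, ∀ η : Fin p → SignType,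
      ξ ∉ frontier (dilates ((fun l => l₀ / l) '' Λ) (signRegion b X l₀ η)) :=
    ae_all_iff.2 fun η => measure_eq_zero_iff_ae_notMem.1 (addHaar_frontier_dilates volume
      (hpoly l₀ hl₀ η).1.convex (hpoly l₀ hl₀ η).2 (hfull l₀ hl₀ η) hT)
  filter_upwards [hae] with ξ hξ
  have hloc := eventually_all.2 fun η => eventually_mem_iff_of_notMem_frontier (hξ η)
  filter_upwards [hloc] with y hy
  ext A
  simp only [hscale.mem_supportPath_iff hl₀ (hpos l₀ hl₀).ne', hy]

theorem ofReal_le_robustnessRadius {ξ : Fin n → ℝ} {ε : ℝ}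
    (h : ∀ y : Fin n → ℝ, ‖y - ξ‖ < ε → supportPath b Λ X y ⊆ supportPath b Λ X ξ) :
    ENNReal.ofReal ε ≤ robustnessRadius b Λ X ξ := by
  refine le_sInf ?_
  rintro _ ⟨y, ⟨l, hl, hne⟩, rfl⟩
  refine ENNReal.ofReal_le_ofReal (not_lt.1 fun hlt => ?_)
  obtain ⟨l', hl', heq⟩ := h y hlt ⟨l, hl, rfl⟩
  exact hne l' hl' heq.symm

end SupportPath

end TuningPath

theorem mainTheorem3 (n p : ℕ) (b : TuningPath.EstimatorFamily n p) (Λ : Set ℝ)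
    (X : Matrix (Fin n) (Fin p) ℝ)
    (hpos : ∀ l ∈ Λ, 0 < l)
    (hscale : TuningPath.IsScaleSymmetric b Λ X)
    (hpoly : TuningPath.HasPolyhedralRegions b Λ X)
    (hΛ : Λ.Finite ∨ TuningPath.HasFullDimensionalRegions b Λ X) :
    ∀ᵐ ξ : Fin n → ℝ ∂volume,
      0 < TuningPath.robustnessRadius b Λ X ξ ∧
      ∃ ε : ℝ, 0 < ε ∧ ∀ y : Fin n → ℝ, ‖y - ξ‖ < ε →
        TuningPath.supportPath b Λ X y = TuningPath.supportPath b Λ X ξ := by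
  have hloc : ∀ᵐ ξ : Fin n → ℝ ∂volume, ∀ᶠ y in 𝓝 ξ,
      TuningPath.supportPath b Λ X y = TuningPath.supportPath b Λ X ξ :=
    hΛ.elim (TuningPath.ae_eventually_supportPath_eq_of_finite hpoly)
      (TuningPath.ae_eventually_supportPath_eq_of_fullDimensional hpos hscale hpoly)
  filter_upwards [hloc] with ξ hξ
  obtain ⟨ε, hε, H⟩ := Metric.eventually_nhds_iff.1 hξ
  simp only [dist_eq_norm] at H
  exact ⟨(ENNReal.ofReal_pos.2 hε).trans_le
    (TuningPath.ofReal_le_robustnessRadius fun y hy => (H hy).subset), ε, hε, fun y hy => H hy⟩
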